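/- Let $q=3^m$, let $s=3^r>3$ with $\gcd(r,2m)=1$, let $a\in\mathbb F_q$ be a nonsquare and let $e\in\mathbb F_q$. A polynomial over $\mathbb F_q$ is called exceptional if it permutes $\mathbb F_{q^k}$ for infinitely many $k$. An exceptional polynomial $g\in\mathbb F_q[x]$ with $g'(0)\neq 0$ is called good over $\mathbb F_q$ if the roots of $$v_g(x)=\frac{g(-x)-g(0)}{-x}$$ in the algebraic closure of $\mathbb F_q$ form a unique orbit under the Frobenius map $x\mapsto x^q$. Consider the polynomial $$f_e(x)=(x+e)\bigl((x+e)^2-a\bigr)^{(s+1)/4}\left(\frac{\bigl((x+e)^2-a\bigr)^{(s-1)/2}+a^{(s-1)/2}}{(x+e)^2}\right)^{(s+1)/2}.$$ Then $f_e$ is an exceptional polynomial over $\mathbb F_q$ with $f_e'(0)\neq 0$, and $f_e$ is not good over $\mathbb F_q$. -/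

import Mathlib

open Polynomial

namespace GoodPolynomials

/-- `f` is exceptional over the finite field `F` if it permutes the extension of degree `k` of `F`
for infinitely many `k`. (Inside an algebraic closure of `F` there is exactly one intermediate
field of each degree `k ≥ 1`.) -/
def IsExceptional {F : Type*} [Field F] (f : F[X]) : Prop :=
  {k : ℕ | ∃ L : IntermediateField F (AlgebraicClosure F),
    FiniteDimensional F L ∧ Module.finrank F L = k ∧
      Function.Bijective (fun x : L => aeval x f)}.Infinite

/-- The polynomial `v_g(x) = (g(-x) - g(0)) / (-x)`; `g.divX` is `(g(x) - g(0)) / x`. -/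
noncomputable def vPoly {F : Type*} [Field F] (g : F[X]) : F[X] :=
  g.divX.comp (-X)

theorem vPoly_mul_neg_X {F : Type*} [Field F] (g : F[X]) :
    vPoly g * (-X) = g.comp (-X) - C (g.eval 0) := by
  have h := congrArg (fun p : F[X] => p.comp (-X)) (divX_mul_X_add g)
  simp only [add_comp, mul_comp, X_comp, C_comp] at h
  rw [vPoly, ← h, coeff_zero_eq_eval_zero]
  ring

/-- The roots of `v` in the algebraic closure of `F` form a unique orbit under the Frobenius map
`x ↦ x ^ q`, where `q` is the order of `F`. -/
def RootsFormUniqueOrbit {F : Type*} [Field F] (v : F[X]) : Prop :=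
  ∃ b : AlgebraicClosure F,
    v.rootSet (AlgebraicClosure F) = Set.range (fun i : ℕ => b ^ (Nat.card F ^ i))

/-- `g` is a good exceptional polynomial over the finite field `F`. The constant term of `g` is
subtracted in `vPoly g`, so `g(0) = 0` is not required. -/
structure IsGood {F : Type*} [Field F] (g : F[X]) : Prop where
  exceptional : IsExceptional g
  derivative_ne_zero : (derivative g).eval 0 ≠ 0
  uniqueOrbit : RootsFormUniqueOrbit (vPoly g)

/-- The polynomial `(((x+e)² - a)^((s-1)/2) + a^((s-1)/2)) / (x+e)²`. -/
noncomputable def typeCQuotient {F : Type*} [Field F] (s : ℕ) (a e : F) : F[X] :=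
  (((X + C e) ^ 2 - C a) ^ ((s - 1) / 2) + C a ^ ((s - 1) / 2)) / (X + C e) ^ 2

/-- The division in `typeCQuotient` is exact when `s` is an odd power of `3`. -/
theorem typeCQuotient_mul {F : Type*} [Field F] (r : ℕ) (hr : Odd r) (a e : F) :
    typeCQuotient (3 ^ r) a e * (X + C e) ^ 2 =
      ((X + C e) ^ 2 - C a) ^ ((3 ^ r - 1) / 2) + C a ^ ((3 ^ r - 1) / 2) := by
  have hodd : Odd ((3 ^ r - 1) / 2) := by
    obtain ⟨k, rfl⟩ := hr
    have h : 3 ^ (2 * k + 1) % 4 = 3 := by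
      rw [pow_succ, pow_mul, Nat.mul_mod, Nat.pow_mod]
      norm_num
    generalize 3 ^ (2 * k + 1) = t at h ⊢
    rw [Nat.odd_iff]
    omega
  have hd := Odd.add_dvd_pow_add_pow ((X + C e) ^ 2 - C a) (C a) hodd
  rw [sub_add_cancel] at hd
  rw [typeCQuotient, mul_comm]
  exact EuclideanDomain.mul_div_cancel' (pow_ne_zero 2 (X_add_C_ne_zero e)) hd

/-- The polynomial `f_e(x)` of degree `s(s-1)/2`. -/
noncomputable def typeCPoly {F : Type*} [Field F] (s : ℕ) (a e : F) : F[X] :=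
  (X + C e) * ((X + C e) ^ 2 - C a) ^ ((s + 1) / 4) * typeCQuotient s a e ^ ((s + 1) / 2)

end GoodPolynomials

/-! Put `X = x + e` and choose `b` with `b ^ 2 = a`. For a value `T ≠ 0`, the substitution `X = b *
N ^ ((s+1)/2)` turns `f_e(x) = T` into the system `N ^ (s+1) = w ^ 2 + 1`, `E * N ^ s = w ^ s + w`,
where `E` depends only on `T`. Its solutions with `N ≠ 0`, the lifts, are the vectors of norm one in
a three-dimensional quadratic space over `𝔽_s`, with form `N ^ (s+1) - w ^ 2`. Points of the fibre
are lifts up to sign. The orthogonal complement of a lift is an anisotropic plane, so two lifts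
pairing to `±1` agree up to sign (`IsLift.eq_of_polar_eq`).

Let `Q = 3 ^ M` with `b ^ Q = -b`. For `T` fixed by the `Q`-power map, that map on the fibre becomes
the twisted Frobenius `(N, w) ↦ (ε⁻¹ * N ^ Q, w ^ Q)`, a semilinear isometry with `ε ^ ((s+1)/2) =
-1`. Rational points give lifts fixed up to sign. The pairing of two such lifts lies in `𝔽_s` and is
fixed up to sign by the `Q`-power map; coprimality of `r` and `M` leaves only `0, 1, -1`. The value
`0` would give an orthonormal basis preserved up to signs, which a spinor invariant forbids
(`false_of_orthonormal_triple`). Hence `f_e` is injective on the extensions whose degree is odd and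
prime to `r`.

For goodness, a Frobenius-invariant property separates the roots of `v`. If `e ≠ 0`, the property is
orthogonality to the lift of the base point `x = 0`: as `s > 3`, roots with zero and with nonzero
pairing both exist (`IsLift.exists_polar_eq`). If `e = 0`, the fibre over `0` splits according to
the factors of `f_0`. -/

namespace GoodPolynomials

/-! ### Norm-one vectors of a quadratic space over `𝔽_s` -/

section Lifts

theorem pow_eq_neg_of_sq_eq_neg_one {K : Type*} [Field K] {h s : ℕ} (hs : s = 4 * h + 3)
    {j : K} (hj : j ^ 2 = -1) :
    j ^ s = -j := by
  have : j ^ s = (j ^ 2) ^ (2 * h + 1) * j := by rw [← pow_mul, ← pow_succ]; congr 1; omega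
  rw [this, hj, Odd.neg_one_pow ⟨h, rfl⟩]; ring

/-- The pairs `(N, w)` that parametrize, up to sign, the roots of `typeCPoly s 1 0 - E ^ ((s+1)/2)`
through `N ↦ N ^ ((s+1)/2)`. -/
structure IsLift {K : Type*} [Field K] (s : ℕ) (E N w : K) : Prop where
  norm : N ^ s * N = w ^ 2 + 1
  trace : E * N ^ s = w ^ s + w

theorem IsLift.neg {K : Type*} [Field K] {h s : ℕ} {E N w : K} (hs : s = 4 * h + 3)
    (H : IsLift s E N w) : IsLift s E (-N) (-w) := by
  have hodd : Odd s := ⟨2 * h + 1, by omega⟩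
  constructor
  · rw [hodd.neg_pow]; linear_combination H.norm
  · rw [hodd.neg_pow, hodd.neg_pow]; linear_combination -H.trace

/-- The polar form of `(N, w) ↦ N ^ (s + 1) - w ^ 2` in characteristic three. -/
def polar {K : Type*} [Field K] (s : ℕ) (N₁ w₁ N₂ w₂ : K) : K :=
  N₁ ^ s * N₂ + N₁ * N₂ ^ s + w₁ * w₂

variable {K : Type*} [Field K] [CharP K 3]

theorem three_eq_zero (K : Type*) [Field K] [CharP K 3] : (3 : K) = 0 := by
  exact_mod_cast CharP.cast_eq_zero K 3

theorem two_ne_zero_of_char_three (K : Type*) [Field K] [CharP K 3] : (2 : K) ≠ 0 := by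
  have h3 := three_eq_zero K
  intro h2
  exact one_ne_zero (α := K) (by linear_combination h3 - h2)

/-- Fixed points of two iterates of the Frobenius with coprime exponents are fixed by it. -/
theorem pow_three_eq_of_coprime {r M : ℕ} (h : Nat.gcd r M = 1) {c : K}
    (h1 : c ^ 3 ^ r = c) (h2 : c ^ 3 ^ M = c) : c ^ 3 = c := by
  have e1 : Function.IsPeriodicPt (frobenius K 3) r c := by
    rw [Function.IsPeriodicPt, Function.IsFixedPt, iterate_frobenius]; exact h1
  have e2 : Function.IsPeriodicPt (frobenius K 3) M c := by
    rw [Function.IsPeriodicPt, Function.IsFixedPt, iterate_frobenius]; exact h2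
  have e3 := e1.gcd e2
  rw [h] at e3
  simpa [Function.IsPeriodicPt, Function.IsFixedPt, frobenius_def] using e3

/-- An element of `𝔽_s`, `s = 3 ^ r` with `r` odd, that the `3 ^ M`-power map fixes up to sign is
`0`, `1` or `-1`. -/
theorem eq_zero_or_one_or_neg_one {h r s M : ℕ} (hsr : s = 3 ^ r) (hs : s = 4 * h + 3)
    (hM : Nat.gcd r M = 1) {b : K} (h1 : b ^ s = b) (h2 : (b ^ 3 ^ M) ^ 2 = b ^ 2) :
    b = 0 ∨ b = 1 ∨ b = -1 := by
  have h3 : (b ^ 2) ^ 3 = b ^ 2 := by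
    refine pow_three_eq_of_coprime hM ?_ ?_
    · rw [← hsr, ← pow_mul, mul_comm, pow_mul, h1]
    · rw [← pow_mul, mul_comm, pow_mul, h2]
  have h4 : b ^ 2 * ((b ^ 2 - 1) * (b ^ 2 + 1)) = 0 := by linear_combination h3
  rcases mul_eq_zero.1 h4 with h5 | h5
  · exact Or.inl (pow_eq_zero_iff two_ne_zero |>.1 h5)
  rcases mul_eq_zero.1 h5 with h5 | h5
  · exact Or.inr (sq_eq_sq_iff_eq_or_eq_neg.1 (by linear_combination h5))
  · have h6 := pow_eq_neg_of_sq_eq_neg_one hs (j := b) (by linear_combination h5)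
    left
    have h7 : 2 * b = 0 := by linear_combination h6 - h1
    exact (mul_eq_zero.1 h7).resolve_left (two_ne_zero_of_char_three K)

variable {h r s : ℕ} {E N w N₁ w₁ N₂ w₂ : K}

/-- Unlike the norm equation, this relation is `𝔽_s`-linear in `(N, w)`; with the trace equation it
cuts out the ambient quadratic space. It comes from dividing by `N ^ s`, and it fails for the
solutions with `N = 0`. -/
theorem IsLift.pow_pow (hsr : s = 3 ^ r) (H : IsLift s E N w) (hN : N ≠ 0) :
    (N ^ s) ^ s = E ^ 2 * N ^ s + E * w + N := by
  have h1 : (N ^ s) ^ s * N ^ s = (w ^ s) ^ 2 + 1 := by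
    rw [← mul_pow, H.norm, hsr, add_pow_char_pow, one_pow, ← pow_mul, ← pow_mul, mul_comm 2]
  have h2 := H.trace
  have h3 := H.norm
  have h0 := three_eq_zero K
  refine mul_right_cancel₀ (pow_ne_zero s hN) ?_
  linear_combination h1 - h3 + (-w ^ s + w - E * N ^ s) * h2  - E * w * N ^ s * h0

theorem IsLift.polar_pow (hsr : s = 3 ^ r) (H₁ : IsLift s E N₁ w₁) (H₂ : IsLift s E N₂ w₂)
    (hN₁ : N₁ ≠ 0) (hN₂ : N₂ ≠ 0) : (polar s N₁ w₁ N₂ w₂) ^ s = polar s N₁ w₁ N₂ w₂ := by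
  have e : (polar s N₁ w₁ N₂ w₂) ^ s =
      (N₁ ^ s) ^ s * N₂ ^ s + N₁ ^ s * (N₂ ^ s) ^ s + w₁ ^ s * w₂ ^ s := by
    simp only [polar, hsr, add_pow_char_pow, mul_pow]
  rw [e, H₁.pow_pow hsr hN₁, H₂.pow_pow hsr hN₂, polar]
  have h1 := H₁.trace
  have h2 := H₂.trace
  have h0 := three_eq_zero K
  linear_combination (-E * N₂ ^ s + w₂) * h1 - w₁ ^ s * h2 + E ^ 2 * N₁ ^ s * N₂ ^ s * h0

/-- A lift pairs to `2 = -1` with itself, so the difference of the two lifts is isotropic and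
orthogonal to the first. That orthogonal complement is anisotropic because `-1` is not a square in
`𝔽_s`. -/
theorem IsLift.eq_of_polar_eq (hsr : s = 3 ^ r) (hs : s = 4 * h + 3)
    (H₁ : IsLift s E N₁ w₁) (H₂ : IsLift s E N₂ w₂) (hN₁ : N₁ ≠ 0)
    (hb : polar s N₁ w₁ N₂ w₂ = -1) : N₁ = N₂ ∧ w₁ = w₂ := by
  have h0 := three_eq_zero K
  have t1 := H₁.trace
  have t2 := H₂.trace
  have n1 := H₁.norm
  have n2 := H₂.norm
  unfold polar at hb
  obtain ⟨N, hN⟩ : ∃ N, N = N₂ - N₁ := ⟨_, rfl⟩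
  obtain ⟨w, hw⟩ : ∃ w, w = w₂ - w₁ := ⟨_, rfl⟩
  have hNs : N ^ s = N₂ ^ s - N₁ ^ s := by rw [hN, hsr, sub_pow_char_pow]
  have hws : w ^ s = w₂ ^ s - w₁ ^ s := by rw [hw, hsr, sub_pow_char_pow]
  have e1 : N ^ s * N = w ^ 2 := by
    rw [hNs, hN, hw]; linear_combination n1 + n2 - hb + (1 + w₁ * w₂) * h0
  have e2 : N₁ ^ s * N + N₁ * N ^ s + w₁ * w = 0 := by
    rw [hNs, hN, hw]; linear_combination hb - 2 * n1 - (w₁ ^ 2 + 1) * h0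
  have e3 : E * N ^ s = w ^ s + w := by
    rw [hNs, hws, hw]; linear_combination t2 - t1
  by_cases hN0 : N = 0
  · have : w = 0 := by
      rw [hN0, mul_zero] at e1
      exact pow_eq_zero_iff two_ne_zero |>.1 e1.symm
    constructor
    · linear_combination hN - hN0
    · linear_combination hw - this
  exfalso
  obtain ⟨T, hT⟩ : ∃ T, w = T * N := ⟨w / N, by field_simp⟩
  have e4 : N ^ s = T ^ 2 * N := by
    refine mul_right_cancel₀ hN0 ?_
    rw [e1, hT]; ring
  have e5 : N₁ ^ s + N₁ * T ^ 2 + w₁ * T = 0 := by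
    refine mul_right_cancel₀ hN0 ?_
    rw [e4, hT] at e2; linear_combination e2
  have e6 : E * T = T ^ s * T + 1 := by
    rw [hT, mul_pow, e4] at e3
    by_cases hT0 : T = 0
    · rw [e4, hT0] at hNs
      simp [hT0] at e4
      exact absurd e4.1 hN0
    refine mul_right_cancel₀ (mul_ne_zero hN0 hT0) ?_
    linear_combination e3
  -- A nonzero isotropic vector of slope `T` produces a square root `j` of `-1`; then `j ^ s = -j`
  -- forces `w₁ = -j`, hence `N₁ = 0`.
  obtain ⟨j, hj⟩ : ∃ j, j = N₁ * T - w₁ := ⟨_, rfl⟩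
  have hj2 : j ^ 2 = -1 := by
    rw [hj]; linear_combination N₁ * e5 - n1 - N₁ * T * w₁ * h0
  have hjs := pow_eq_neg_of_sq_eq_neg_one hs hj2
  have e7 : N₁ ^ s * T ^ s = w₁ ^ s - j := by
    have : (N₁ * T) ^ s = (w₁ + j) ^ s := by rw [hj]; ring
    rw [mul_pow, hsr, add_pow_char_pow, ← hsr, hjs] at this
    linear_combination this
  have e8 : (w₁ + j) * (2 * j) = 0 := by
    linear_combination (N₁ ^ s * N₁) * e6 - N₁ * T * t1 + N₁ * T * e7 + n1 + hj2 + (w₁ + j) * hj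
  have hj0 : j ≠ 0 := fun h => by simp [h] at hj2
  have e9 := (mul_eq_zero.1 e8).resolve_right
    (mul_ne_zero (two_ne_zero_of_char_three K) hj0)
  have e10 : N₁ ^ s * N₁ = 0 := by linear_combination n1 + (w₁ - j) * e9 + hj2
  exact mul_ne_zero (pow_ne_zero s hN₁) hN₁ e10

/-- Two lifts of the same root agree up to sign. -/
theorem IsLift.eq_or_eq_neg (hsr : s = 3 ^ r) (hs : s = 4 * h + 3)
    (H₁ : IsLift s E N₁ w₁) (H₂ : IsLift s E N₂ w₂) (hE : E ≠ 0)
    (hN : N₁ ^ (2 * h + 2) = N₂ ^ (2 * h + 2)) :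
    (N₁ = N₂ ∧ w₁ = w₂) ∨ (N₁ = -N₂ ∧ w₁ = -w₂) := by
  have hinj : ∀ {x y : K}, x ^ s = y ^ s → x = y := fun {x y} hxy => by
    rw [hsr, ← iterateFrobenius_def, ← iterateFrobenius_def] at hxy
    exact (iterateFrobenius K 3 r).injective hxy
  have hodd : Odd s := ⟨2 * h + 1, by omega⟩
  have key : ∀ n : K, n ^ s * n = (n ^ (2 * h + 2)) ^ 2 := fun n => by
    rw [← pow_succ, ← pow_mul]; congr 1; omega
  have hw : w₁ ^ 2 = w₂ ^ 2 := by
    have h1 := H₁.norm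
    have h2 := H₂.norm
    rw [key, hN, ← key] at h1
    linear_combination h2 - h1
  rcases sq_eq_sq_iff_eq_or_eq_neg.1 hw with rfl | rfl
  · refine Or.inl ⟨hinj (mul_left_cancel₀ hE ?_), rfl⟩
    rw [H₁.trace, H₂.trace]
  · refine Or.inr ⟨hinj (mul_left_cancel₀ hE ?_), rfl⟩
    rw [H₁.trace, hodd.neg_pow, hodd.neg_pow, mul_neg, H₂.trace]; ring

end Lifts
end GoodPolynomials

namespace GoodPolynomials

/-! ### Uniqueness of lifts fixed by the twisted Frobenius -/

section Injectivity

theorem exists_sq_sq_mul {K : Type*} [Field K] [IsAlgClosed K] {A B C : K} (hC : C ^ 2 = A * B) :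
    ∃ y z : K, y ^ 2 = A ∧ z ^ 2 = B ∧ y * z = C := by
  obtain ⟨y, hy⟩ := IsAlgClosed.exists_pow_nat_eq A (n := 2) two_pos
  obtain ⟨z, hz⟩ := IsAlgClosed.exists_pow_nat_eq B (n := 2) two_pos
  have h1 : (y * z) ^ 2 = C ^ 2 := by rw [hC, mul_pow, hy, hz]
  rcases sq_eq_sq_iff_eq_or_eq_neg.1 h1 with h1 | h1
  · exact ⟨y, z, hy, hz, h1⟩
  · exact ⟨y, -z, hy, by rw [neg_sq, hz], by rw [mul_neg, h1, neg_neg]⟩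

variable {K : Type*} [Field K] [CharP K 3]
variable {h r s M : ℕ} {E ε N w N₁ w₁ N₂ w₂ N₃ w₃ κ κ₁ κ₂ : K}

/-- No orthonormal triple of lifts is stable, up to signs, under the twisted Frobenius. -/
theorem false_of_orthonormal_triple [IsAlgClosed K] (hsr : s = 3 ^ r) (hs : s = 4 * h + 3)
    (hε : ε ^ (2 * h + 2) = -1) (h1 : N₁ ^ 2 + N₂ ^ 2 + N₃ ^ 2 = 0)
    (h2 : N₁ ^ s * N₁ + N₂ ^ s * N₂ + N₃ ^ s * N₃ = -1)
    (f1 : N₁ ^ 3 ^ M = ε * N₁) (f2 : N₂ ^ 3 ^ M = κ * ε * N₂) (f3 : N₃ ^ 3 ^ M = κ * ε * N₃)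
    (hκ : κ = 1 ∨ κ = -1) : False := by
  have h0 := three_eq_zero K
  have hodd : Odd s := ⟨2 * h + 1, by omega⟩
  have hQodd : Odd (3 ^ M) := Odd.pow ⟨1, rfl⟩
  -- The vector `(N₁, N₂, N₃)` is isotropic, so the standard parametrization of a conic writes it
  -- through a spinor `(y, z)`, unique up to sign.
  obtain ⟨y, z, hy, hz, hyz⟩ := exists_sq_sq_mul
    (A := N₂ + N₃ - N₁) (B := -(N₁ + N₂ + N₃)) (C := N₃ - N₂)
    (by linear_combination -h1 + (N₂ ^ 2 + N₃ ^ 2) * h0)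
  have hys : (y ^ s) ^ 2 = N₂ ^ s + N₃ ^ s - N₁ ^ s := by
    rw [← pow_mul, mul_comm, pow_mul, hy, hsr, sub_pow_char_pow, add_pow_char_pow]
  have hzs : (z ^ s) ^ 2 = -(N₁ ^ s + N₂ ^ s + N₃ ^ s) := by
    rw [← pow_mul, mul_comm, pow_mul, hz, hodd.neg_pow, hsr, add_pow_char_pow, add_pow_char_pow]
  have hyzs : y ^ s * z ^ s = N₃ ^ s - N₂ ^ s := by
    rw [← mul_pow, hyz, hsr, sub_pow_char_pow]
  -- The alternating form of the spinor with its `s`-power. Its square is `1`, so Frobenius fixes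
  -- it, whereas the twist will negate it.
  obtain ⟨δ, hδ⟩ : ∃ δ, δ = y ^ s * z - y * z ^ s := ⟨_, rfl⟩
  have hδ2 : δ ^ 2 = 1 := by
    have : δ ^ 2 = (y ^ s) ^ 2 * z ^ 2 + y ^ 2 * (z ^ s) ^ 2 - 2 * (y ^ s * z ^ s) * (y * z) := by
      rw [hδ]; ring
    rw [this, hys, hzs, hyzs, hy, hz, hyz]
    linear_combination -h2 + (N₁ ^ s * N₁ - N₂ ^ s * N₂ - N₃ ^ s * N₃) * h0
  have hδQ : δ ^ 3 ^ M = δ := by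
    rcases sq_eq_sq_iff_eq_or_eq_neg.1 (hδ2.trans (one_pow 2).symm) with h | h
    · rw [h, one_pow]
    · rw [h, hQodd.neg_one_pow]
  have hδneg : δ ^ 3 ^ M = -δ := by
    have hyQ : (y ^ 3 ^ M) ^ 2 = κ * ε * N₂ + κ * ε * N₃ - ε * N₁ := by
      rw [← pow_mul, mul_comm, pow_mul, hy, sub_pow_char_pow, add_pow_char_pow, f1, f2, f3]
    have hzQ : (z ^ 3 ^ M) ^ 2 = -(ε * N₁ + κ * ε * N₂ + κ * ε * N₃) := by
      rw [← pow_mul, mul_comm, pow_mul, hz, hQodd.neg_pow, add_pow_char_pow, add_pow_char_pow,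
        f1, f2, f3]
    have hyzQ : y ^ 3 ^ M * z ^ 3 ^ M = κ * ε * N₃ - κ * ε * N₂ := by
      rw [← mul_pow, hyz, sub_pow_char_pow, f2, f3]
    -- The twist acts on spinors through a square root of `ε`, up to sign and, when `κ = -1`, with a
    -- swap of `y` and `z`. The value of `y * z` decides the relative sign, and `δ` is multiplied by
    -- `l ^ (s+1) = -1`.
    obtain ⟨l, hl⟩ := IsAlgClosed.exists_pow_nat_eq ε (n := 2) two_pos
    have hls : l ^ s * l = -1 := by
      rw [← pow_succ, show s + 1 = 2 * (2 * h + 2) by omega, pow_mul, hl, hε]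
    have hyz0 : y * z ≠ 0 := by
      intro h
      have : δ = 0 := by
        rcases mul_eq_zero.1 h with h | h <;> simp [hδ, h, show s ≠ 0 by omega]
      simp [this] at hδ2
    have hε0 : ε ≠ 0 := by rintro rfl; simp at hε
    have hδ' : δ ^ 3 ^ M = (y ^ 3 ^ M) ^ s * z ^ 3 ^ M - y ^ 3 ^ M * (z ^ 3 ^ M) ^ s := by
      rw [hδ, sub_pow_char_pow, mul_pow, mul_pow, ← pow_mul, ← pow_mul, ← pow_mul, ← pow_mul,
        mul_comm s]
    rcases hκ with rfl | rfl
    · have a1 : (y ^ 3 ^ M) ^ 2 = (l * y) ^ 2 := by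
        rw [hyQ, mul_pow, hl, hy]; ring
      have a2 : (z ^ 3 ^ M) ^ 2 = (l * z) ^ 2 := by
        rw [hzQ, mul_pow, hl, hz]; ring
      have a3 : y ^ 3 ^ M * z ^ 3 ^ M = ε * (y * z) := by
        rw [hyzQ, hyz]; ring
      rw [hδ', hδ]
      rcases sq_eq_sq_iff_eq_or_eq_neg.1 a1 with b1 | b1 <;>
      rcases sq_eq_sq_iff_eq_or_eq_neg.1 a2 with b2 | b2 <;>
      rw [b1, b2] at a3 ⊢ <;> simp only [hodd.neg_pow, mul_pow]
      · linear_combination (y ^ s * z - y * z ^ s) * hls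
      · refine absurd ?_ (mul_ne_zero hε0 hyz0)
        linear_combination a3 + y * z * hl + ε * y * z * h0
      · refine absurd ?_ (mul_ne_zero hε0 hyz0)
        linear_combination a3 + y * z * hl + ε * y * z * h0
      · linear_combination (y ^ s * z - y * z ^ s) * hls
    · have a1 : (y ^ 3 ^ M) ^ 2 = (l * z) ^ 2 := by
        rw [hyQ, mul_pow, hl, hz]; ring
      have a2 : (z ^ 3 ^ M) ^ 2 = (l * y) ^ 2 := by
        rw [hzQ, mul_pow, hl, hy]; ring
      have a3 : y ^ 3 ^ M * z ^ 3 ^ M = -ε * (y * z) := by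
        rw [hyzQ, hyz]; ring
      rw [hδ', hδ]
      rcases sq_eq_sq_iff_eq_or_eq_neg.1 a1 with b1 | b1 <;>
      rcases sq_eq_sq_iff_eq_or_eq_neg.1 a2 with b2 | b2 <;>
      rw [b1, b2] at a3 ⊢ <;> simp only [hodd.neg_pow, mul_pow]
      · refine absurd ?_ (mul_ne_zero hε0 hyz0)
        linear_combination -a3 + y * z * hl + ε * y * z * h0
      · linear_combination (y ^ s * z - y * z ^ s) * hls
      · linear_combination (y ^ s * z - y * z ^ s) * hls
      · refine absurd ?_ (mul_ne_zero hε0 hyz0)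
        linear_combination -a3 + y * z * hl + ε * y * z * h0
  have : 2 * δ = 0 := by linear_combination hδneg - hδQ
  rw [(mul_eq_zero.1 this).resolve_left (two_ne_zero_of_char_three K)] at hδ2
  simp at hδ2

/-- Two orthogonal lifts are completed to an orthonormal triple by their cross product, which the
twist fixes up to the product of the two signs. -/
theorem IsLift.polar_ne_zero [IsAlgClosed K] (hsr : s = 3 ^ r) (hs : s = 4 * h + 3)
    (hε : ε ^ (2 * h + 2) = -1) (H₁ : IsLift s E N₁ w₁) (H₂ : IsLift s E N₂ w₂)
    (f1 : N₁ ^ 3 ^ M = κ₁ * ε * N₁) (g1 : w₁ ^ 3 ^ M = κ₁ * w₁) (hκ₁ : κ₁ = 1 ∨ κ₁ = -1)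
    (f2 : N₂ ^ 3 ^ M = κ₂ * ε * N₂) (g2 : w₂ ^ 3 ^ M = κ₂ * w₂) (hκ₂ : κ₂ = 1 ∨ κ₂ = -1) :
    polar s N₁ w₁ N₂ w₂ ≠ 0 := by
  intro hb
  unfold polar at hb
  have h0 := three_eq_zero K
  have n1 := H₁.norm
  have n2 := H₂.norm
  have t1 := H₁.trace
  have t2 := H₂.trace
  obtain ⟨N₃, hN₃⟩ : ∃ N₃, N₃ = N₁ * w₂ - N₂ * w₁ := ⟨_, rfl⟩
  have f3 : N₃ ^ 3 ^ M = κ₁ * κ₂ * ε * N₃ := by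
    rw [hN₃, sub_pow_char_pow, mul_pow, mul_pow, f1, f2, g1, g2]; ring
  have hN₃s : N₃ ^ s = -N₁ ^ s * w₂ + N₂ ^ s * w₁ := by
    rw [hN₃, hsr, sub_pow_char_pow, mul_pow, mul_pow, ← hsr]
    linear_combination -N₁ ^ s * t2 + N₂ ^ s * t1
  have h1 : N₁ ^ 2 + N₂ ^ 2 + N₃ ^ 2 = 0 := by
    rw [hN₃]
    linear_combination -N₁ ^ 2 * n2 - N₂ ^ 2 * n1 + N₁ * N₂ * hb - N₁ * N₂ * w₁ * w₂ * h0
  have h2 : N₁ ^ s * N₁ + N₂ ^ s * N₂ + N₃ ^ s * N₃ = -1 := by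
    rw [hN₃s, hN₃]
    linear_combination (1 - w₂ ^ 2) * n1 + (1 - w₁ ^ 2) * n2 + w₁ * w₂ * hb
      + (1 - w₁ ^ 2 * w₂ ^ 2) * h0
  -- The three signs multiply to `1`, so a vector of sign `+1` can be placed first and the other two
  -- share a sign.
  rcases hκ₁ with rfl | rfl <;> rcases hκ₂ with rfl | rfl
  · exact false_of_orthonormal_triple hsr hs hε h1 h2 (by simpa using f1) f2 (by simpa using f3)
      (Or.inl rfl)
  · exact false_of_orthonormal_triple hsr hs hε h1 h2 (by simpa using f1) f2 (by simpa using f3)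
      (Or.inr rfl)
  · exact false_of_orthonormal_triple (N₁ := N₂) (N₂ := N₁) (N₃ := N₃) hsr hs hε
      (by linear_combination h1) (by linear_combination h2) (by simpa using f2) f1
      (by simpa using f3) (Or.inr rfl)
  · exact false_of_orthonormal_triple (N₁ := N₃) (N₂ := N₁) (N₃ := N₂) hsr hs hε
      (by linear_combination h1) (by linear_combination h2) (by simpa using f3) f1 f2 (Or.inr rfl)

/-- The twist is a semilinear isometry because `ε ^ (s+1) = 1`. -/
theorem polar_pow_eq (hs : s = 4 * h + 3) (hε : ε ^ (2 * h + 2) = -1)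
    (f1 : N₁ ^ 3 ^ M = κ₁ * ε * N₁) (g1 : w₁ ^ 3 ^ M = κ₁ * w₁) (hκ₁ : κ₁ = 1 ∨ κ₁ = -1)
    (f2 : N₂ ^ 3 ^ M = ε * N) (g2 : w₂ ^ 3 ^ M = w) :
    (polar s N₁ w₁ N₂ w₂) ^ 3 ^ M = κ₁ * polar s N₁ w₁ N w := by
  have hεs : ε ^ s * ε = 1 := by
    rw [← pow_succ, show s + 1 = (2 * h + 2) * 2 by omega, pow_mul, hε]; ring
  have hκs : κ₁ ^ s = κ₁ := by
    have hodd : Odd s := ⟨2 * h + 1, by omega⟩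
    rcases hκ₁ with rfl | rfl
    · exact one_pow s
    · exact hodd.neg_one_pow
  have e : ∀ n : K, (n ^ s) ^ 3 ^ M = (n ^ 3 ^ M) ^ s := fun n => by
    rw [← pow_mul, ← pow_mul, mul_comm]
  simp only [polar, add_pow_char_pow, mul_pow, e, f1, f2, g1, g2, hκs]
  linear_combination (κ₁ * N₁ ^ s * N + κ₁ * N₁ * N ^ s) * hεs

/-- Lifts that are fixed up to sign by the twisted Frobenius are unique up to sign. -/
theorem IsLift.eq_or_eq_neg_of_fixed [IsAlgClosed K] (hsr : s = 3 ^ r) (hs : s = 4 * h + 3)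
    (hM : Nat.gcd r M = 1)
    (hε : ε ^ (2 * h + 2) = -1) (H₁ : IsLift s E N₁ w₁) (H₂ : IsLift s E N₂ w₂)
    (hN₁ : N₁ ≠ 0) (hN₂ : N₂ ≠ 0)
    (f1 : N₁ ^ 3 ^ M = κ₁ * ε * N₁) (g1 : w₁ ^ 3 ^ M = κ₁ * w₁) (hκ₁ : κ₁ = 1 ∨ κ₁ = -1)
    (f2 : N₂ ^ 3 ^ M = κ₂ * ε * N₂) (g2 : w₂ ^ 3 ^ M = κ₂ * w₂) (hκ₂ : κ₂ = 1 ∨ κ₂ = -1) :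
    (N₁ = N₂ ∧ w₁ = w₂) ∨ (N₁ = -N₂ ∧ w₁ = -w₂) := by
  have hb0 := H₁.polar_ne_zero hsr hs hε H₂ f1 g1 hκ₁ f2 g2 hκ₂
  have hbs := H₁.polar_pow hsr H₂ hN₁ hN₂
  have hbQ := polar_pow_eq (N := κ₂ * N₂) (w := κ₂ * w₂) hs hε f1 g1 hκ₁
    (by rw [f2]; ring) g2
  have hodd : Odd s := ⟨2 * h + 1, by omega⟩
  have hneg : polar s N₁ w₁ (-N₂) (-w₂) = -polar s N₁ w₁ N₂ w₂ := by
    simp only [polar, hodd.neg_pow]; ring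
  have hb2 : (polar s N₁ w₁ N₂ w₂ ^ 3 ^ M) ^ 2 = polar s N₁ w₁ N₂ w₂ ^ 2 := by
    rw [hbQ]
    rcases hκ₁ with rfl | rfl <;> rcases hκ₂ with rfl | rfl <;> simp [hneg]
  rcases eq_zero_or_one_or_neg_one hsr hs hM hbs hb2 with h | h | h
  · exact absurd h hb0
  · exact Or.inr (H₁.eq_of_polar_eq hsr hs (H₂.neg hs) hN₁ (by rw [hneg, h]))
  · exact Or.inl (H₁.eq_of_polar_eq hsr hs H₂ hN₁ h)

end Injectivity
end GoodPolynomials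

namespace GoodPolynomials

/-! ### Fibres of the polynomial as sets of lifts -/

section Evaluation

variable {F K : Type*} [Field F] [Field K] [Algebra F K]
variable {h r s M : ℕ}

theorem odd_of_eq_three_pow (hsr : s = 3 ^ r) (hs : s = 4 * h + 3) : Odd r := by
  rcases Nat.even_or_odd r with ⟨k, rfl⟩ | hr
  · exfalso
    have : s % 4 = 1 := by
      rw [hsr, ← two_mul, pow_mul, Nat.pow_mod]; norm_num
    omega
  · exact hr

theorem typeCQuotient_mul_sq (hsr : s = 3 ^ r) (hs : s = 4 * h + 3) (a e : F) :
    typeCQuotient s a e * (X + C e) ^ 2 =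
      ((X + C e) ^ 2 - C a) ^ (2 * h + 1) + C a ^ (2 * h + 1) := by
  have := typeCQuotient_mul r (odd_of_eq_three_pow hsr hs) a e
  rwa [← hsr, show (s - 1) / 2 = 2 * h + 1 by omega] at this

theorem typeCPoly_eq (hs : s = 4 * h + 3) (a e : F) :
    typeCPoly s a e = (X + C e) * ((X + C e) ^ 2 - C a) ^ (h + 1) *
      typeCQuotient s a e ^ (2 * h + 2) := by
  rw [typeCPoly, show (s + 1) / 4 = h + 1 by omega, show (s + 1) / 2 = 2 * h + 2 by omega]

theorem aeval_typeCQuotient_mul (hsr : s = 3 ^ r) (hs : s = 4 * h + 3) (a e : F) (x : K) :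
    aeval x (typeCQuotient s a e) * (x + algebraMap F K e) ^ 2 =
      ((x + algebraMap F K e) ^ 2 - algebraMap F K a) ^ (2 * h + 1)
        + algebraMap F K a ^ (2 * h + 1) := by
  simpa using congrArg (aeval x) (typeCQuotient_mul_sq hsr hs a e)

theorem aeval_typeCPoly (hs : s = 4 * h + 3) (a e : F) (x : K) :
    aeval x (typeCPoly s a e) =
      (x + algebraMap F K e) * ((x + algebraMap F K e) ^ 2 - algebraMap F K a) ^ (h + 1) *
        aeval x (typeCQuotient s a e) ^ (2 * h + 2) := by
  simp [typeCPoly_eq hs]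

/-- The source of the lift equations: `X ^ 2 - a` becomes `a * w ^ 2`, and multiplying by `X ^ s`
clears the denominator and leaves a perfect `(s+1)/2`-th power. -/
theorem aeval_typeCPoly_mul_pow (hsr : s = 3 ^ r) (hs : s = 4 * h + 3) (a e : F) {b ξ w x : K}
    (hb : b ^ 2 = algebraMap F K a) (hx : x + algebraMap F K e = b * ξ) (hw : w ^ 2 = ξ ^ 2 - 1) :
    aeval x (typeCPoly s a e) * (b * ξ) ^ s =
      algebraMap F K a ^ (h + 1 + (2 * h + 1) * (2 * h + 2)) * (w ^ s + w) ^ (2 * h + 2) := by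
  have h1 := aeval_typeCQuotient_mul hsr hs a e x
  have h2 : (x + algebraMap F K e) ^ 2 - algebraMap F K a = algebraMap F K a * w ^ 2 := by
    rw [hx, hw, mul_pow, hb]; ring
  rw [aeval_typeCPoly hs, h2]
  rw [h2] at h1
  rw [hx] at h1 ⊢
  generalize algebraMap F K a = α at *
  generalize aeval x (typeCQuotient s a e) = u at *
  have h3 : w ^ s + w = (w ^ (4 * h + 2) + 1) * w := by rw [hs]; ring
  have h4 : u * (b * ξ) ^ 2 = α ^ (2 * h + 1) * (w ^ (4 * h + 2) + 1) := by
    rw [h1, mul_pow, ← pow_mul, show 2 * (2 * h + 1) = 4 * h + 2 by ring]; ring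
  calc b * ξ * (α * w ^ 2) ^ (h + 1) * u ^ (2 * h + 2) * (b * ξ) ^ s
      = (u * (b * ξ) ^ 2) ^ (2 * h + 2) * (α * w ^ 2) ^ (h + 1) := by
        rw [mul_pow u, ← pow_mul, show 2 * (2 * h + 2) = s + 1 by omega]; ring
    _ = α ^ (h + 1 + (2 * h + 1) * (2 * h + 2)) * (w ^ s + w) ^ (2 * h + 2) := by
        rw [h4, h3, mul_pow, mul_pow, mul_pow, ← pow_mul, ← pow_mul, pow_add, pow_mul w]; ring

variable {E ε N w b : K}

/-- The sign comes from `b ^ s` on the right of `hT`: `b` is negated by the power map and `s` is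
odd. -/
theorem twist_pow (hs : s = 4 * h + 3) {a : F} {T : K}
    (hE : E ≠ 0) (hb : b ^ 2 = algebraMap F K a) (hb0 : b ≠ 0)
    (hT : E ^ (2 * h + 2) * algebraMap F K a ^ (h + 1 + (2 * h + 1) * (2 * h + 2)) = T * b ^ s)
    (hTQ : T ^ 3 ^ M = T) (haQ : algebraMap F K a ^ 3 ^ M = algebraMap F K a)
    (hbQ : b ^ 3 ^ M = -b) (hε : E ^ 3 ^ M = ε * E) : ε ^ (2 * h + 2) = -1 := by
  have hodd : Odd s := ⟨2 * h + 1, by omega⟩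
  have ha0 : algebraMap F K a ≠ 0 := by rw [← hb]; exact pow_ne_zero 2 hb0
  have e : ∀ (n : K) (i : ℕ), (n ^ i) ^ 3 ^ M = (n ^ 3 ^ M) ^ i := fun n i => by
    rw [← pow_mul, ← pow_mul, mul_comm]
  have h1 := congrArg (· ^ 3 ^ M) hT
  simp only [mul_pow, e] at h1
  rw [hTQ, haQ, hbQ, hε, hodd.neg_pow, mul_pow, mul_neg, ← hT] at h1
  refine mul_right_cancel₀ (mul_ne_zero (pow_ne_zero (2 * h + 2) hE)
      (pow_ne_zero (h + 1 + (2 * h + 1) * (2 * h + 2)) ha0)) ?_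
  linear_combination h1

theorem mul_pow_twist (hε' : ε ^ (2 * h + 2) = -1) (hbQ : b ^ 3 ^ M = -b) :
    (b * N ^ (2 * h + 2)) ^ 3 ^ M = b * (ε⁻¹ * N ^ 3 ^ M) ^ (2 * h + 2) := by
  rw [mul_pow, mul_pow, hbQ, inv_pow, hε', ← pow_mul, ← pow_mul, mul_comm (2 * h + 2)]
  norm_num

theorem IsLift.aeval_eq (hsr : s = 3 ^ r) (hs : s = 4 * h + 3) (a e : F)
    {b E N w x T : K} (H : IsLift s E N w) (hN : N ≠ 0)
    (hb : b ^ 2 = algebraMap F K a) (hb0 : b ≠ 0) (hx : x + algebraMap F K e = b * N ^ (2 * h + 2))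
    (hT : E ^ (2 * h + 2) * algebraMap F K a ^ (h + 1 + (2 * h + 1) * (2 * h + 2)) = T * b ^ s) :
    aeval x (typeCPoly s a e) = T := by
  have hw : w ^ 2 = (N ^ (2 * h + 2)) ^ 2 - 1 := by
    rw [← pow_mul, show (2 * h + 2) * 2 = s + 1 by omega, pow_succ N, H.norm]; ring
  have h1 := aeval_typeCPoly_mul_pow hsr hs a e hb hx hw
  refine mul_right_cancel₀ (pow_ne_zero s (mul_ne_zero hb0 (pow_ne_zero (2 * h + 2) hN))) ?_
  rw [h1, ← H.trace, mul_pow, mul_pow, ← mul_assoc T, ← hT, ← pow_mul, ← pow_mul, mul_comm s]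
  ring

theorem exists_twist_parameter [IsAlgClosed K] (a : F) (hb : b ^ 2 = algebraMap F K a)
    (hb0 : b ≠ 0) {T : K} (hT : T ≠ 0) : ∃ E : K, E ≠ 0 ∧
      E ^ (2 * h + 2) * algebraMap F K a ^ (h + 1 + (2 * h + 1) * (2 * h + 2)) = T * b ^ s := by
  have ha0 : algebraMap F K a ≠ 0 := by rw [← hb]; exact pow_ne_zero 2 hb0
  obtain ⟨E, hE⟩ := IsAlgClosed.exists_pow_nat_eq
    (T * b ^ s / algebraMap F K a ^ (h + 1 + (2 * h + 1) * (2 * h + 2))) (n := 2 * h + 2)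
    (by omega)
  refine ⟨E, ?_, by rw [hE]; field_simp⟩
  rintro rfl
  rw [zero_pow (by omega)] at hE
  exact div_ne_zero (mul_ne_zero hT (pow_ne_zero s hb0)) (pow_ne_zero _ ha0) hE.symm

variable [CharP K 3]

theorem pow_injective_of_eq_three_pow (hsr : s = 3 ^ r) {x y : K} (hxy : x ^ s = y ^ s) :
    x = y := by
  rw [hsr, ← iterateFrobenius_def, ← iterateFrobenius_def] at hxy
  exact (iterateFrobenius K 3 r).injective hxy

theorem exists_isLift [IsAlgClosed K] (hsr : s = 3 ^ r) (hs : s = 4 * h + 3) (a e : F)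
    {b E x : K} (hb : b ^ 2 = algebraMap F K a) (hb0 : b ≠ 0) (hE : E ≠ 0)
    (hx : x + algebraMap F K e ≠ 0)
    (hT : E ^ (2 * h + 2) * algebraMap F K a ^ (h + 1 + (2 * h + 1) * (2 * h + 2)) =
      aeval x (typeCPoly s a e) * b ^ s) :
    ∃ N w, IsLift s E N w ∧ N ≠ 0 ∧ x + algebraMap F K e = b * N ^ (2 * h + 2) := by
  obtain ⟨ξ, hξ⟩ : ∃ ξ, x + algebraMap F K e = b * ξ :=
    ⟨(x + algebraMap F K e) / b, by field_simp⟩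
  obtain ⟨w, hw⟩ := IsAlgClosed.exists_pow_nat_eq (ξ ^ 2 - 1) (n := 2) two_pos
  -- Extracting `N` from the trace equation, rather than as a root of `ξ`, leaves no ambiguity by
  -- roots of unity; `N ^ (2 * h + 2) = ξ` then follows by injectivity of the `s`-power map.
  obtain ⟨N, hN⟩ := IsAlgClosed.exists_pow_nat_eq ((w ^ s + w) / E) (n := s) (by omega)
  have h1 := aeval_typeCPoly_mul_pow hsr hs a e hb hξ hw
  have htr : E * N ^ s = w ^ s + w := by rw [hN]; field_simp
  have ha0 : algebraMap F K a ≠ 0 := by rw [← hb]; exact pow_ne_zero 2 hb0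
  have h2 : N ^ (2 * h + 2) = ξ := by
    refine pow_injective_of_eq_three_pow hsr ?_
    refine mul_left_cancel₀ (mul_ne_zero (pow_ne_zero (2 * h + 2) hE)
      (pow_ne_zero (h + 1 + (2 * h + 1) * (2 * h + 2)) ha0)) ?_
    rw [← htr] at h1
    calc _ = algebraMap F K a ^ (h + 1 + (2 * h + 1) * (2 * h + 2)) *
          (E * N ^ s) ^ (2 * h + 2) := by rw [mul_pow, ← pow_mul, ← pow_mul, mul_comm s]; ring
      _ = _ := by rw [← h1, hT]; ring
  refine ⟨N, w, ⟨?_, htr⟩, ?_, by rw [h2, hξ]⟩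
  · rw [← pow_succ, show s + 1 = (2 * h + 2) * 2 by omega, pow_mul, h2, hw]; ring
  · rintro rfl
    rw [zero_pow (by omega)] at h2
    exact hx (by rw [hξ, ← h2, mul_zero])

/-- The twisted Frobenius acts on lifts. -/
theorem IsLift.twist (hs : s = 4 * h + 3) (H : IsLift s E N w) (hε : E ^ 3 ^ M = ε * E)
    (hε' : ε ^ (2 * h + 2) = -1) : IsLift s E (ε⁻¹ * N ^ 3 ^ M) (w ^ 3 ^ M) := by
  have hε0 : ε ≠ 0 := by rintro rfl; simp at hε'
  have hεs : ε ^ s * ε = 1 := by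
    rw [← pow_succ, show s + 1 = (2 * h + 2) * 2 by omega, pow_mul, hε']; ring
  have hεs' : (ε⁻¹) ^ s = ε := by
    rw [inv_pow]; exact inv_eq_of_mul_eq_one_right hεs
  have e : ∀ (n : K) (i : ℕ), (n ^ i) ^ 3 ^ M = (n ^ 3 ^ M) ^ i := fun n i => by
    rw [← pow_mul, ← pow_mul, mul_comm]
  constructor
  · have h1 := congrArg (· ^ 3 ^ M) H.norm
    simp only [mul_pow, e, add_pow_char_pow, one_pow] at h1
    rw [mul_pow, hεs', ← h1]
    field_simp
  · have h1 := congrArg (· ^ 3 ^ M) H.trace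
    simp only [mul_pow, e, add_pow_char_pow, hε] at h1
    rw [mul_pow, hεs', ← h1]
    ring

theorem eq_one_of_pow_eq_one (hsr : s = 3 ^ r) (hs : s = 4 * h + 3) (hM : Nat.gcd r M = 1)
    {c : K} (h1 : c ^ (2 * h + 1) = 1) (h2 : c ^ 3 ^ M = c) : c = 1 := by
  have hc0 : c ≠ 0 := by rintro rfl; simp at h1
  have h3 : c ^ s = c := by
    rw [show s = (2 * h + 1) * 2 + 1 by omega, pow_succ, pow_mul, h1]; ring
  rcases eq_zero_or_one_or_neg_one hsr hs hM h3 (by rw [h2]) with h | h | h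
  · exact absurd h hc0
  · exact h
  · rw [h, Odd.neg_one_pow ⟨_, rfl⟩] at h1
    rw [h, h1]

/-- A rational point is no root of the factor `x ^ 2 - α`, and the only rational root of
`(x ^ 2 - α) ^ ((s-1)/2) + α ^ ((s-1)/2)` is `0`. -/
theorem rational_zero (hsr : s = 3 ^ r) (hs : s = 4 * h + 3) (hM : Nat.gcd r M = 1) {α X : K}
    (hb : b ^ 2 = α) (hb0 : b ≠ 0) (hbQ : b ^ 3 ^ M = -b) (hX : X ^ 3 ^ M = X) :
    X ^ 2 - α ≠ 0 ∧ ((X ^ 2 - α) ^ (2 * h + 1) + α ^ (2 * h + 1) = 0 → X = 0) := by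
  have h2 := two_ne_zero_of_char_three K
  constructor
  · intro h
    have : X ^ 2 = b ^ 2 := by linear_combination h - hb
    have : b ^ 3 ^ M = b := by
      rcases sq_eq_sq_iff_eq_or_eq_neg.1 this with h | h
      · rw [← h, hX]
      · rw [show b = -X by rw [h, neg_neg], Odd.neg_pow (Odd.pow (a := 3) ⟨1, rfl⟩), hX]
    exact mul_ne_zero h2 hb0 (by linear_combination hbQ - this)
  · intro hq
    have hα0 : α ≠ 0 := by rw [← hb]; exact pow_ne_zero 2 hb0
    have hαQ : α ^ 3 ^ M = α := by
      rw [← hb, ← pow_mul, mul_comm, pow_mul, hbQ, neg_sq]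
    -- This ratio is a root of unity of order dividing `(s-1)/2`, and it is rational.
    have h3 : (α - X ^ 2) / α = 1 := by
      refine eq_one_of_pow_eq_one hsr hs hM ?_ ?_
      · rw [div_pow, div_eq_one_iff_eq (pow_ne_zero _ hα0), ← neg_sub,
          Odd.neg_pow ⟨h, rfl⟩]
        linear_combination -hq
      · rw [div_pow, sub_pow_char_pow, hαQ, ← pow_mul, mul_comm, pow_mul, hX]
    rw [div_eq_one_iff_eq hα0] at h3
    exact pow_eq_zero_iff two_ne_zero |>.1 (by linear_combination -h3)

theorem aeval_typeCPoly_eq_zero (hsr : s = 3 ^ r) (hs : s = 4 * h + 3) (hM : Nat.gcd r M = 1)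
    (a e : F) (hb : b ^ 2 = algebraMap F K a) (hb0 : b ≠ 0) (hbQ : b ^ 3 ^ M = -b)
    (heQ : algebraMap F K e ^ 3 ^ M = algebraMap F K e) {x : K} (hx : x ^ 3 ^ M = x)
    (h0 : aeval x (typeCPoly s a e) = 0) : x + algebraMap F K e = 0 := by
  have h1 := rational_zero hsr hs hM hb hb0 hbQ (X := x + algebraMap F K e)
    (by rw [add_pow_char_pow, hx, heQ])
  rw [aeval_typeCPoly hs, mul_eq_zero, mul_eq_zero] at h0
  rcases h0 with (h0 | h0) | h0
  · exact h0
  · exact absurd (pow_eq_zero_iff (by omega) |>.1 h0) h1.1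
  · refine h1.2 ?_
    rw [← aeval_typeCQuotient_mul hsr hs, pow_eq_zero_iff (by omega) |>.1 h0, zero_mul]

/-- The lift of a rational point is fixed up to sign by the twisted Frobenius. -/
theorem IsLift.exists_sign (hsr : s = 3 ^ r) (hs : s = 4 * h + 3) (H : IsLift s E N w)
    (hE : E ≠ 0) (hb0 : b ≠ 0) (hbQ : b ^ 3 ^ M = -b) (hε : E ^ 3 ^ M = ε * E)
    (hε' : ε ^ (2 * h + 2) = -1)
    (hX : (b * N ^ (2 * h + 2)) ^ 3 ^ M = b * N ^ (2 * h + 2)) :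
    ∃ κ : K, (κ = 1 ∨ κ = -1) ∧ N ^ 3 ^ M = κ * ε * N ∧ w ^ 3 ^ M = κ * w := by
  have hε0 : ε ≠ 0 := by rintro rfl; simp at hε'
  rw [mul_pow_twist hε' hbQ] at hX
  rcases (H.twist hs hε hε').eq_or_eq_neg hsr hs H hE (mul_left_cancel₀ hb0 hX) with
    ⟨h1, h2⟩ | ⟨h1, h2⟩
  · exact ⟨1, Or.inl rfl, by rw [one_mul, ← inv_mul_eq_iff_eq_mul₀ hε0, h1], by rw [h2, one_mul]⟩
  · refine ⟨-1, Or.inr rfl, ?_, by rw [h2]; ring⟩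
    rw [inv_mul_eq_iff_eq_mul₀ hε0] at h1
    rw [h1]; ring

theorem typeCPoly_injOn [IsAlgClosed K] (hsr : s = 3 ^ r) (hs : s = 4 * h + 3)
    (hM : Nat.gcd r M = 1) (a e : F) (hb : b ^ 2 = algebraMap F K a) (hb0 : b ≠ 0)
    (hbQ : b ^ 3 ^ M = -b) (haQ : algebraMap F K a ^ 3 ^ M = algebraMap F K a)
    (heQ : algebraMap F K e ^ 3 ^ M = algebraMap F K e) {x₁ x₂ T : K}
    (h1 : x₁ ^ 3 ^ M = x₁) (h2 : x₂ ^ 3 ^ M = x₂) (hT : T ^ 3 ^ M = T)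
    (hT₁ : aeval x₁ (typeCPoly s a e) = T) (hT₂ : aeval x₂ (typeCPoly s a e) = T) :
    x₁ = x₂ := by
  by_cases hT0 : T = 0
  · rw [hT0] at hT₁ hT₂
    have e1 := aeval_typeCPoly_eq_zero hsr hs hM a e hb hb0 hbQ heQ h1 hT₁
    have e2 := aeval_typeCPoly_eq_zero hsr hs hM a e hb hb0 hbQ heQ h2 hT₂
    linear_combination e1 - e2
  obtain ⟨E, hE, hET⟩ := exists_twist_parameter (s := s) (h := h) a hb hb0 hT0
  obtain ⟨ε, hε⟩ : ∃ ε, E ^ 3 ^ M = ε * E := ⟨E ^ 3 ^ M / E, by field_simp⟩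
  have hε' := twist_pow hs hE hb hb0 hET hT haQ hbQ hε
  have key : ∀ x : K, x ^ 3 ^ M = x → aeval x (typeCPoly s a e) = T →
      ∃ N w κ, IsLift s E N w ∧ N ≠ 0 ∧ x + algebraMap F K e = b * N ^ (2 * h + 2) ∧
        (κ = 1 ∨ κ = -1) ∧ N ^ 3 ^ M = κ * ε * N ∧ w ^ 3 ^ M = κ * w := by
    intro x hx hxT
    have hX0 : x + algebraMap F K e ≠ 0 := by
      intro h0
      rw [aeval_typeCPoly hs, h0, zero_mul, zero_mul] at hxT
      exact hT0 hxT.symm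
    obtain ⟨N, w, H, hN, hX⟩ := exists_isLift hsr hs a e hb hb0 hE hX0 (by rw [hxT, hET])
    obtain ⟨κ, hκ, f, g⟩ := H.exists_sign hsr hs hE hb0 hbQ hε hε'
      (by rw [← hX, add_pow_char_pow, hx, heQ])
    exact ⟨N, w, κ, H, hN, hX, hκ, f, g⟩
  obtain ⟨N₁, w₁, κ₁, H₁, hN₁, hX₁, hκ₁, f₁, g₁⟩ := key x₁ h1 hT₁
  obtain ⟨N₂, w₂, κ₂, H₂, hN₂, hX₂, hκ₂, f₂, g₂⟩ := key x₂ h2 hT₂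
  have heven : Even (2 * h + 2) := ⟨h + 1, by ring⟩
  have hN : N₁ ^ (2 * h + 2) = N₂ ^ (2 * h + 2) := by
    rcases H₁.eq_or_eq_neg_of_fixed hsr hs hM hε' H₂ hN₁ hN₂ f₁ g₁ hκ₁ f₂ g₂ hκ₂ with h3 | h3
    · rw [h3.1]
    · rw [h3.1, heven.neg_pow]
  rw [← hN, ← hX₁] at hX₂
  exact add_right_cancel hX₂.symm

end Evaluation
end GoodPolynomials

namespace GoodPolynomials

/-! ### Derivative at zero and exceptionality -/

section FiniteFields

variable {F : Type*} [Field F] {h r s M : ℕ}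

theorem natCast_eq_zero_of_eq_three_pow [CharP F 3] (hsr : s = 3 ^ r) (hs : s = 4 * h + 3)
    (hr : r ≠ 0) : (h : F[X]) = 0 := by
  have h1 : 3 ∣ h := by
    have : 3 ∣ s := hsr ▸ dvd_pow_self 3 hr
    omega
  exact (CharP.cast_eq_zero_iff F[X] 3 h).2 h1

theorem derivative_sq_sub (a e : F) :
    derivative ((X + C e) ^ 2 - C a) = 2 * (X + C e) := by
  rw [derivative_sub, derivative_pow, derivative_C, derivative_X_add_C, map_natCast]
  push_cast
  ring

theorem derivative_typeCQuotient [CharP F 3] (hsr : s = 3 ^ r) (hs : s = 4 * h + 3)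
    (hr : r ≠ 0) (a e : F) :
    derivative (typeCQuotient s a e) * (X + C e) + 2 * typeCQuotient s a e =
      2 * ((X + C e) ^ 2 - C a) ^ (2 * h) := by
  have h2 := congrArg derivative (typeCQuotient_mul_sq hsr hs a e)
  have hh := natCast_eq_zero_of_eq_three_pow (F := F) hsr hs hr
  simp only [derivative_mul, derivative_add, derivative_pow, derivative_sq_sub,
    derivative_C, derivative_X, map_natCast, Nat.add_sub_cancel] at h2
  push_cast at h2
  rw [hh] at h2
  refine mul_right_cancel₀ (X_add_C_ne_zero e) ?_
  linear_combination h2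

/-- Since `3 ∣ h`, the exponents `h + 1` and `2 * h + 2` act as `1` and `2`, and the terms collapse
to a product whose factors have no zero at a rational point. -/
theorem derivative_typeCPoly [CharP F 3] (hsr : s = 3 ^ r) (hs : s = 4 * h + 3) (hr : r ≠ 0)
    (a e : F) : derivative (typeCPoly s a e) =
      -C a ^ (2 * h + 1) * ((X + C e) ^ 2 - C a) ^ h * typeCQuotient s a e ^ (2 * h + 1) := by
  have h1 := typeCQuotient_mul_sq hsr hs a e
  have h3 : (3 : F[X]) = 0 := by exact_mod_cast CharP.cast_eq_zero F[X] 3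
  have hh := natCast_eq_zero_of_eq_three_pow (F := F) hsr hs hr
  have hA' := derivative_sq_sub a e
  have h4 := derivative_typeCQuotient hsr hs hr a e
  have hY' : derivative (X + C e : F[X]) = 1 := derivative_X_add_C e
  rw [typeCPoly_eq hs]
  generalize typeCQuotient s a e = q at *
  generalize (X + C e : F[X]) = Y at *
  generalize (C a : F[X]) = α at *
  obtain ⟨A, hA⟩ : ∃ A, A = Y ^ 2 - α := ⟨_, rfl⟩
  rw [← hA] at h1 h4 hA' ⊢
  simp only [derivative_mul, derivative_pow, hA', hY', map_natCast, Nat.add_sub_cancel]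
  rw [show 2 * h + 2 - 1 = 2 * h + 1 by omega]
  push_cast
  rw [hh]
  generalize derivative q = q' at *
  have e1 : A ^ (2 * h) = (A ^ h) ^ 2 := by rw [mul_comm, pow_mul]
  have e2 : q ^ (2 * h + 1) = (q ^ h) ^ 2 * q := by rw [pow_succ, mul_comm 2, pow_mul]
  have e4 : q ^ (2 * h + 2) = (q ^ h) ^ 2 * q ^ 2 := by rw [pow_add, mul_comm 2, pow_mul]
  rw [pow_succ A, e1] at h1
  rw [e1] at h4
  rw [pow_succ A, e2, e4]
  linear_combination 2 * A ^ h * A * (q ^ h) ^ 2 * q * h4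
    + 2 * A ^ h * (q ^ h) ^ 2 * q * h1
    + (α ^ (2 * h + 1) * A ^ h * (q ^ h) ^ 2 * q - A ^ h * A * (q ^ h) ^ 2 * q ^ 2
      + 2 * A ^ h * A * (q ^ h) ^ 2 * q * (A ^ h) ^ 2) * h3

theorem eval_zero_derivative_typeCPoly [CharP F 3] (hsr : s = 3 ^ r) (hs : s = 4 * h + 3)
    (hr : r ≠ 0)
    (hM : Nat.gcd r M = 1) {K : Type*} [Field K] [Algebra F K] [CharP K 3] {a e : F} {b : K}
    (hb : b ^ 2 = algebraMap F K a) (hb0 : b ≠ 0) (hbQ : b ^ 3 ^ M = -b)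
    (heQ : e ^ 3 ^ M = e) : (derivative (typeCPoly s a e)).eval 0 ≠ 0 := by
  have hinj := (algebraMap F K).injective
  have ha0 : a ≠ 0 := by
    rintro rfl
    rw [map_zero] at hb
    exact hb0 (pow_eq_zero_iff two_ne_zero |>.1 hb)
  have h1 := rational_zero hsr hs hM hb hb0 hbQ (X := algebraMap F K e)
    (by rw [← map_pow, heQ])
  have hA : e ^ 2 - a ≠ 0 := fun h0 => h1.1 (by rw [← map_pow, ← map_sub, h0, map_zero])
  have h2 := congrArg (eval 0) (typeCQuotient_mul_sq hsr hs a e)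
  have h3 := congrArg (eval 0) (derivative_typeCQuotient hsr hs hr a e)
  have hq : eval 0 (typeCQuotient s a e) ≠ 0 := by
    intro h0
    have hM' := h1.2 (by
      have h4 := congrArg (algebraMap F K) h2
      simp only [eval_mul, h0, zero_mul, map_zero] at h4
      simpa using h4.symm)
    -- The point `0` really is a root of the numerator, so this case needs the derivative relation,
    -- which gives the quotient a nonzero value there.
    have he : e = 0 := (map_eq_zero _).1 hM'
    simp only [eval_add, eval_mul, eval_sub, eval_pow, eval_X, eval_C, eval_ofNat, h0, zero_add]
      at h3
    refine mul_ne_zero (two_ne_zero_of_char_three F) (pow_ne_zero (2 * h) hA) ?_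
    rw [← h3, he]
    ring
  rw [derivative_typeCPoly hsr hs hr]
  simp [ha0, hA, hq]

theorem exists_sqrt_pow_card [Finite F] {m : ℕ} [CharP F 3] (hq : Nat.card F = 3 ^ m)
    (K : Type*) [Field K] [Algebra F K] [IsAlgClosed K] {a : F} (ha : ¬ IsSquare a) :
    ∃ b : K, b ^ 2 = algebraMap F K a ∧ b ≠ 0 ∧ b ^ 3 ^ m = -b := by
  have : Fintype F := Fintype.ofFinite F
  have ha0 : a ≠ 0 := by rintro rfl; exact ha ⟨0, by simp⟩
  have hF : ringChar F ≠ 2 := by rw [ringChar.eq F 3]; norm_num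
  obtain ⟨b, hb⟩ := IsAlgClosed.exists_pow_nat_eq (algebraMap F K a) (n := 2) two_pos
  refine ⟨b, hb, ?_, ?_⟩
  · rintro rfl
    rw [zero_pow two_ne_zero] at hb
    exact ha0 ((map_eq_zero _).1 hb.symm)
  have h1 : a ^ (Fintype.card F / 2) = -1 :=
    (FiniteField.pow_dichotomy hF ha0).resolve_left
      fun h1 => ha ((FiniteField.isSquare_iff hF ha0).2 h1)
  rw [← hq, Nat.card_eq_fintype_card, ← Nat.two_mul_div_two_add_one_of_odd
    (Nat.odd_iff.2 (FiniteField.odd_card_of_char_ne_two hF)), pow_succ, pow_mul, hb, ← map_pow, h1]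
  simp

theorem exists_intermediateField [Finite F] [CharP F 3] {k : ℕ} (hk : k ≠ 0) :
    ∃ L : IntermediateField F (AlgebraicClosure F),
      FiniteDimensional F L ∧ Module.finrank F L = k := by
  have : NeZero k := ⟨hk⟩
  let φ : FiniteField.Extension F 3 k →ₐ[F] AlgebraicClosure F := IsAlgClosed.lift
  have e := AlgEquiv.ofInjectiveField φ
  refine ⟨φ.fieldRange, Module.Finite.equiv e.toLinearEquiv, ?_⟩
  exact (LinearEquiv.finrank_eq e.toLinearEquiv).symm.trans (FiniteField.finrank_extension F 3 k)

theorem typeCPoly_isExceptional [Finite F] [CharP F 3] {m : ℕ} (hq : Nat.card F = 3 ^ m)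
    (hsr : s = 3 ^ r) (hs : s = 4 * h + 3) (hM : Nat.gcd r m = 1) (a e : F)
    (ha : ¬ IsSquare a) : IsExceptional (typeCPoly s a e) := by
  have : CharP (AlgebraicClosure F) 3 := charP_of_injective_algebraMap
    (algebraMap F (AlgebraicClosure F)).injective 3
  obtain ⟨b, hb, hb0, hbq⟩ := exists_sqrt_pow_card hq (AlgebraicClosure F) ha
  -- Degrees `2 * r * j + 1` are odd, which keeps `b ^ (q ^ k) = -b`, and prime to `r`.
  refine Set.infinite_of_injective_forall_mem (f := fun j : ℕ => 2 * r * j + 1) ?_ ?_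
  · intro i j hij
    have hr0 : r ≠ 0 := by rintro rfl; omega
    simpa [hr0] using hij
  intro j
  obtain ⟨k, hk⟩ : ∃ k, k = 2 * r * j + 1 := ⟨_, rfl⟩
  obtain ⟨L, hfin, hrank⟩ := exists_intermediateField (F := F) (k := k) (by omega)
  refine ⟨L, hfin, by rw [hrank, hk], ?_⟩
  have : Finite L := Module.finite_of_finite F
  refine Finite.injective_iff_bijective.1 ?_
  have hcard : Nat.card L = 3 ^ (m * k) := by
    rw [Module.natCard_eq_pow_finrank (K := F), hq, hrank, pow_mul]
  have : Fintype L := Fintype.ofFinite L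
  have hL : ∀ x : L, (x : AlgebraicClosure F) ^ 3 ^ (m * k) = x := fun x => by
    rw [← hcard, Nat.card_eq_fintype_card]
    exact_mod_cast FiniteField.pow_card x
  have hFL : ∀ c : F, algebraMap F (AlgebraicClosure F) c ^ 3 ^ (m * k) = algebraMap F _ c :=
    fun c => hL (algebraMap F L c)
  have hbQ : b ^ 3 ^ (m * k) = -b := by
    have : ∀ i, b ^ 3 ^ (m * (2 * i + 1)) = -b := fun i => by
      induction i with
      | zero => simpa using hbq
      | succ i ih =>
        rw [show m * (2 * (i + 1) + 1) = m * (2 * i + 1) + m + m by ring, pow_add, pow_add,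
          pow_mul, pow_mul, ih, Odd.neg_pow (Odd.pow (a := 3) ⟨1, rfl⟩), hbq, neg_neg, hbq]
    rw [hk, mul_assoc]
    exact this _
  have hM' : Nat.gcd r (m * k) = 1 := by
    refine Nat.Coprime.mul_right hM ?_
    rw [hk, show 2 * r * j + 1 = 1 + r * (2 * j) by ring]
    simp
  intro x y hxy
  refine Subtype.ext (typeCPoly_injOn hsr hs hM' a e hb hb0 hbQ (hFL a) (hFL e) (hL x) (hL y)
    (hL (aeval y (typeCPoly s a e))) ?_ ?_)
  · have := congrArg (algebraMap L (AlgebraicClosure F)) hxy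
    simp only [← aeval_algebraMap_apply] at this
    rw [show ((aeval y (typeCPoly s a e) : L) : AlgebraicClosure F) =
      algebraMap L (AlgebraicClosure F) (aeval y (typeCPoly s a e)) from rfl,
      ← aeval_algebraMap_apply]
    exact this
  · exact aeval_algebraMap_apply (AlgebraicClosure F) y _

end FiniteFields
end GoodPolynomials

namespace GoodPolynomials

/-! ### Invariant properties of roots, and lifts with prescribed pairing -/

section Orbits

theorem not_rootsFormUniqueOrbit {F : Type*} [Field F] {v : F[X]}
    (P : AlgebraicClosure F → Prop)
    (hP : ∀ y ∈ v.rootSet (AlgebraicClosure F), (P y ↔ P (y ^ Nat.card F)))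
    {y₁ y₂ : AlgebraicClosure F} (h₁ : y₁ ∈ v.rootSet (AlgebraicClosure F))
    (h₂ : y₂ ∈ v.rootSet (AlgebraicClosure F)) (hP₁ : P y₁) (hP₂ : ¬ P y₂) :
    ¬ RootsFormUniqueOrbit v := by
  rintro ⟨b, hb⟩
  have key : ∀ i : ℕ, P b ↔ P (b ^ Nat.card F ^ i) := fun i => by
    induction i with
    | zero => simp
    | succ i ih =>
      rw [ih, pow_succ, pow_mul]
      exact hP _ (hb ▸ ⟨i, rfl⟩)
  rw [hb] at h₁ h₂
  obtain ⟨i, rfl⟩ := h₁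
  obtain ⟨j, rfl⟩ := h₂
  exact hP₂ ((key j).1 ((key i).2 hP₁))

theorem eval_zero_vPoly {F : Type*} [Field F] (g : F[X]) :
    (vPoly g).eval 0 = (derivative g).eval 0 := by
  rw [vPoly, eval_comp, eval_neg, eval_X, neg_zero, ← coeff_zero_eq_eval_zero,
    ← coeff_zero_eq_eval_zero, coeff_divX, coeff_derivative]
  simp

theorem mem_rootSet_vPoly {F K : Type*} [Field F] [Field K] [Algebra F K] {g : F[X]}
    (hg : (derivative g).eval 0 ≠ 0) (y : K) :
    y ∈ (vPoly g).rootSet K ↔ y ≠ 0 ∧ aeval (-y) g = algebraMap F K (g.eval 0) := by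
  have h0 : (vPoly g) ≠ 0 := fun h => hg (by rw [← eval_zero_vPoly, h, eval_zero])
  have h1 := congrArg (aeval y) (vPoly_mul_neg_X g)
  simp only [map_mul, map_neg, aeval_X, map_sub, aeval_comp, aeval_C] at h1
  rw [mem_rootSet, and_iff_right h0]
  constructor
  · intro h
    refine ⟨?_, by rw [h, zero_mul] at h1; exact (sub_eq_zero.1 h1.symm)⟩
    rintro rfl
    have h2 := aeval_algebraMap_apply K (0 : F) (vPoly g)
    rw [map_zero, h, coe_aeval_eq_eval, eval_zero_vPoly] at h2
    exact hg ((map_eq_zero _).1 h2.symm)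
  · rintro ⟨hy, h⟩
    rw [h, sub_self] at h1
    exact (mul_eq_zero.1 h1).resolve_right (neg_ne_zero.2 hy)

variable {K : Type*} [Field K] [CharP K 3] {h r s : ℕ}

theorem exists_pow_eq_self [IsAlgClosed K] (hsr : s = 3 ^ r) (hr : r ≠ 0) (hs3 : 3 < s) :
    ∃ d : K, d ^ (s - 1) = 1 ∧ d ^ 2 ≠ 1 := by
  have : NeZero ((s - 1 : ℕ) : K) := ⟨by
    rw [Nat.cast_sub (by omega), hsr, Nat.cast_pow, Nat.cast_ofNat, three_eq_zero K,
      zero_pow hr, Nat.cast_one, zero_sub]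
    exact neg_ne_zero.2 one_ne_zero⟩
  obtain ⟨d, hd⟩ := HasEnoughRootsOfUnity.exists_primitiveRoot K (s - 1)
  exact ⟨d, hd.pow_eq_one, hd.pow_ne_one_of_pos_of_lt two_ne_zero (by omega)⟩

/-- Lifts with a prescribed polar pairing with a given lift. -/
theorem IsLift.exists_polar_eq [IsAlgClosed K] (hsr : s = 3 ^ r) (hs : s = 4 * h + 3)
    {E N w d : K} (H : IsLift s E N w) (hE : E ≠ 0) (hN : N ≠ 0) (hd : d ^ s = d)
    (hd1 : d ^ 2 ≠ 1) : ∃ N' w', IsLift s E N' w' ∧ N' ≠ 0 ∧ polar s N w N' w' = -d := by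
  have h0 := three_eq_zero K
  obtain ⟨i, hi⟩ := IsAlgClosed.exists_pow_nat_eq (-1 : K) (n := 2) two_pos
  have his := pow_eq_neg_of_sq_eq_neg_one hs hi
  -- The new lift is `d` times the old one plus an orthogonal vector of norm `1 - d ^ 2`. The
  -- orthogonal plane is a copy of `𝔽_{s²}` with coordinate `c`, and `c ^ (s+1) = d ^ 2 - 1` sets
  -- the norm.
  obtain ⟨c, hc⟩ := IsAlgClosed.exists_pow_nat_eq (d ^ 2 - 1) (n := s + 1) (by omega)
  obtain ⟨α, hα⟩ := IsAlgClosed.exists_pow_nat_eq (w + i) (n := s + 1) (by omega)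
  rw [pow_succ] at hc hα
  have hn := H.norm
  have ht := H.trace
  have hwi : (w + i) * (w - i) ≠ 0 := by
    rw [show (w + i) * (w - i) = N ^ s * N by rw [hn]; linear_combination -hi]
    exact mul_ne_zero (pow_ne_zero s hN) hN
  have hα0 : α ≠ 0 := by
    rintro rfl
    rw [mul_zero] at hα
    exact left_ne_zero_of_mul hwi hα.symm
  -- Factoring `N ^ (s+1) = (w + i) * (w - i)` gives spinor coordinates `α, β`; the orthogonal plane
  -- is spanned by quadratic expressions in them.
  obtain ⟨β, hβ⟩ : ∃ β, α * β = N := ⟨N / α, by field_simp⟩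
  have hNs : α ^ s * β ^ s = N ^ s := by rw [← mul_pow, hβ]
  have hβ1 : β ^ s * β = w - i := by
    refine mul_left_cancel₀ (left_ne_zero_of_mul hwi) ?_
    rw [← hα]
    linear_combination N ^ s * hβ + α * β * hNs + hn + hi - (w - i) * hα
  have hβ0 : β ≠ 0 := by
    rintro rfl
    rw [mul_zero] at hβ1
    exact right_ne_zero_of_mul hwi hβ1.symm
  have hαα : (α ^ s) ^ s = E * β ^ s - α := by
    have h1 := congrArg (· ^ s) hα
    simp only [mul_pow] at h1
    rw [show (w + i) ^ s = w ^ s - i by rw [hsr, add_pow_char_pow, ← hsr, his]; ring] at h1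
    refine mul_right_cancel₀ (pow_ne_zero s hα0) ?_
    linear_combination h1 + hα - ht - E * hNs
  have hββ : (β ^ s) ^ s = E * α ^ s - β := by
    have h1 := congrArg (· ^ s) hβ1
    simp only [mul_pow] at h1
    rw [show (w - i) ^ s = w ^ s + i by rw [hsr, sub_pow_char_pow, ← hsr, his]; ring] at h1
    refine mul_right_cancel₀ (pow_ne_zero s hβ0) ?_
    linear_combination h1 + hβ1 - ht - E * hNs
  have hc0 : c ≠ 0 := by
    rintro rfl
    rw [mul_zero] at hc
    exact hd1 (by linear_combination -hc)
  have hcc : (c ^ s) ^ s = c := by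
    have h1 := congrArg (· ^ s) hc
    simp only [mul_pow] at h1
    rw [show (d ^ 2 - 1) ^ s = d ^ 2 - 1 by
      rw [hsr, sub_pow_char_pow, ← hsr, one_pow, ← pow_mul, mul_comm, pow_mul, hd], ← hc] at h1
    refine mul_right_cancel₀ (pow_ne_zero s hc0) ?_
    linear_combination h1
  obtain ⟨N', hN'⟩ : ∃ N', N' = d * N + c * α ^ 2 + c ^ s * β ^ 2 := ⟨_, rfl⟩
  obtain ⟨w', hw'⟩ : ∃ w', w' = d * w + c * (α * β ^ s) + c ^ s * (α ^ s * β) := ⟨_, rfl⟩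
  have e : ∀ x : K, (x ^ 2) ^ s = (x ^ s) ^ 2 := fun x => by rw [← pow_mul, ← pow_mul, mul_comm]
  have hN's : N' ^ s = d * N ^ s + c ^ s * (α ^ s) ^ 2 + c * (β ^ s) ^ 2 := by
    have : N' ^ s = d ^ s * N ^ s + c ^ s * (α ^ 2) ^ s + (c ^ s) ^ s * (β ^ 2) ^ s := by
      rw [hN', ← mul_pow, ← mul_pow, ← mul_pow, hsr, add_pow_char_pow, add_pow_char_pow]
    rw [this, hd, hcc, e, e]
  have hw's : w' ^ s = d * w ^ s + c ^ s * (α ^ s * (β ^ s) ^ s) + c * ((α ^ s) ^ s * β ^ s) := by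
    have : w' ^ s = d ^ s * w ^ s + c ^ s * (α * β ^ s) ^ s + (c ^ s) ^ s * (α ^ s * β) ^ s := by
      rw [hw', ← mul_pow, ← mul_pow, ← mul_pow, hsr, add_pow_char_pow, add_pow_char_pow]
    rw [this, hd, hcc, mul_pow, mul_pow]
  have hnorm : N' ^ s * N' = w' ^ 2 + 1 := by
    rw [hN's, hN', hw', ← hNs, ← hβ]
    have e1 : (d * (α ^ s * β ^ s) + c ^ s * (α ^ s) ^ 2 + c * (β ^ s) ^ 2) *
          (d * (α * β) + c * α ^ 2 + c ^ s * β ^ 2) -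
          (d * w + c * (α * β ^ s) + c ^ s * (α ^ s * β)) ^ 2
        = d ^ 2 * ((α ^ s * α) * (β ^ s * β) - w ^ 2) +
          d * (c * (α * β ^ s) + c ^ s * (α ^ s * β)) * (α ^ s * α + β ^ s * β - 2 * w) +
          c ^ s * c * (α ^ s * α - β ^ s * β) ^ 2 := by ring
    rw [hα, hβ1, hc] at e1
    linear_combination e1 + (3 * d ^ 2 - 4) * hi + (1 - d ^ 2) * h0
  refine ⟨N', w', ⟨hnorm, ?_⟩, ?_, ?_⟩
  · rw [hw's, hN's, hαα, hββ, hw']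
    linear_combination d * ht
  · intro hN0
    -- `IsLift.pow_pow` presupposes `N' ≠ 0`, so its linear relation is verified directly for the
    -- new vector; with `N' = 0` it would force `w' = 0`, against norm one.
    have e2 : (N' ^ s) ^ s = d * ((α ^ s) ^ s * (β ^ s) ^ s) + c * ((α ^ s) ^ s) ^ 2 +
        c ^ s * ((β ^ s) ^ s) ^ 2 := by
      have : (N' ^ s) ^ s = d ^ s * (N ^ s) ^ s + (c ^ s) ^ s * ((α ^ s) ^ 2) ^ s +
          c ^ s * ((β ^ s) ^ 2) ^ s := by
        rw [hN's, ← mul_pow, ← mul_pow, ← mul_pow, hsr, add_pow_char_pow, add_pow_char_pow]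
      rw [this, hd, hcc, e, e, ← hNs, mul_pow]
    have e3 : (N' ^ s) ^ s = E ^ 2 * N' ^ s + E * w' + N' := by
      rw [e2, hαα, hββ, hN's, hN', hw', ← hNs, ← hβ]
      linear_combination (-E * d) * hα - E * d * hβ1
        - E * (d * w + c * α * β ^ s + c ^ s * α ^ s * β) * h0
    have hs0 : s ≠ 0 := by omega
    rw [hN0, zero_pow hs0, zero_pow hs0, mul_zero, zero_add, add_zero] at e3
    have e4 : w' = 0 := (mul_eq_zero.1 e3.symm).resolve_left hE
    rw [hN0, e4, mul_zero] at hnorm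
    norm_num at hnorm
  · rw [polar, hN's, hN', hw', ← hNs, ← hβ]
    linear_combination (2 * d * (β ^ s * β) + c * (α * β ^ s) + c ^ s * (α ^ s * β)) * hα
      + (2 * d * (w + i) + c * (α * β ^ s) + c ^ s * (α ^ s * β)) * hβ1 - 2 * d * hi
      + (c * w * (α * β ^ s) + c ^ s * w * (α ^ s * β) + d * w ^ 2 + d) * h0

end Orbits
end GoodPolynomials

namespace GoodPolynomials

/-! ### Failure of the single-orbit condition -/

section NotGood

variable {F : Type*} [Field F] {h r s m : ℕ}

/-- The roots `±b` of the factor `x ^ 2 - a` and the roots of the quotient are both stable under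
Frobenius, and both occur. -/
theorem not_rootsFormUniqueOrbit_zero [CharP F 3] (hq : Nat.card F = 3 ^ m)
    (hsr : s = 3 ^ r) (hs : s = 4 * h + 3) (hr : r ≠ 0) (hs3 : 3 < s) {a : F}
    {b : AlgebraicClosure F} (hb : b ^ 2 = algebraMap F _ a) (hb0 : b ≠ 0)
    (hg : (derivative (typeCPoly s a 0)).eval 0 ≠ 0) :
    ¬ RootsFormUniqueOrbit (vPoly (typeCPoly s a 0)) := by
  have : CharP (AlgebraicClosure F) 3 := charP_of_injective_algebraMap
    (algebraMap F (AlgebraicClosure F)).injective 3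
  have hg0 : (typeCPoly s a (0 : F)).eval 0 = 0 := by simp [typeCPoly_eq hs]
  have ha0 : algebraMap F (AlgebraicClosure F) a ≠ 0 := by rw [← hb]; exact pow_ne_zero 2 hb0
  have haq : (algebraMap F (AlgebraicClosure F) a) ^ 3 ^ m = algebraMap F _ a := by
    have : Finite F := Nat.finite_of_card_ne_zero (by rw [hq]; positivity)
    have : Fintype F := Fintype.ofFinite F
    rw [← map_pow, ← hq, Nat.card_eq_fintype_card, FiniteField.pow_card]
  obtain ⟨d, hd1, hd2⟩ := exists_pow_eq_self (K := AlgebraicClosure F) hsr hr hs3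
  have hd0 : d ≠ 0 := by
    rintro rfl
    rw [zero_pow (by omega)] at hd1
    exact zero_ne_one hd1
  obtain ⟨x, hx⟩ := IsAlgClosed.exists_pow_nat_eq (algebraMap F (AlgebraicClosure F) a *
    (1 - d ^ 2)) (n := 2) two_pos
  have hx0 : x ≠ 0 := by
    rintro rfl
    rw [zero_pow two_ne_zero] at hx
    exact mul_ne_zero ha0 (sub_ne_zero.2 hd2.symm) hx.symm
  refine not_rootsFormUniqueOrbit (fun y => y ^ 2 = algebraMap F _ a) (fun y _ => ?_)
    (y₁ := b) (y₂ := x) ((mem_rootSet_vPoly hg b).2 ⟨hb0, ?_⟩)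
    ((mem_rootSet_vPoly hg x).2 ⟨hx0, ?_⟩) hb ?_
  · rw [hq, ← pow_mul, mul_comm, pow_mul]
    constructor
    · intro h1
      rw [h1, haq]
    · intro h1
      exact pow_injective_of_eq_three_pow (s := 3 ^ m) rfl (h1.trans haq.symm)
  · rw [aeval_typeCPoly hs, hg0]
    simp [hb]
  · have h1 := aeval_typeCQuotient_mul hsr hs a 0 (-x)
    rw [map_zero, add_zero, neg_sq, hx, show algebraMap F (AlgebraicClosure F) a * (1 - d ^ 2) -
      algebraMap F _ a = -(algebraMap F _ a * d ^ 2) by ring, Odd.neg_pow ⟨h, rfl⟩, mul_pow,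
      ← pow_mul, show 2 * (2 * h + 1) = s - 1 by omega, hd1, mul_one, neg_add_cancel, ← hx] at h1
    rw [aeval_typeCPoly hs, (mul_eq_zero.1 h1).resolve_right (pow_ne_zero 2 hx0), hg0]
    simp
  · intro h1
    rw [hx] at h1
    have h2 : algebraMap F (AlgebraicClosure F) a * d ^ 2 = 0 := by linear_combination -h1
    exact mul_ne_zero ha0 (pow_ne_zero 2 hd0) h2

theorem not_rootsFormUniqueOrbit_of_ne_zero [Finite F] [CharP F 3] (hq : Nat.card F = 3 ^ m)
    (hsr : s = 3 ^ r) (hs : s = 4 * h + 3) (hr : r ≠ 0) (hs3 : 3 < s) (hM : Nat.gcd r m = 1)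
    {a e : F} (he : e ≠ 0) {b : AlgebraicClosure F} (hb : b ^ 2 = algebraMap F _ a) (hb0 : b ≠ 0)
    (hbq : b ^ 3 ^ m = -b) (hg : (derivative (typeCPoly s a e)).eval 0 ≠ 0) :
    ¬ RootsFormUniqueOrbit (vPoly (typeCPoly s a e)) := by
  have : CharP (AlgebraicClosure F) 3 := charP_of_injective_algebraMap
    (algebraMap F (AlgebraicClosure F)).injective 3
  have hodd : Odd s := ⟨2 * h + 1, by omega⟩
  have heven : Even (2 * h + 2) := ⟨h + 1, by ring⟩
  have hFq : ∀ c : F, algebraMap F (AlgebraicClosure F) c ^ 3 ^ m = algebraMap F _ c := fun c => by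
    have : Fintype F := Fintype.ofFinite F
    rw [← map_pow, ← hq, Nat.card_eq_fintype_card, FiniteField.pow_card]
  have he' : algebraMap F (AlgebraicClosure F) e ≠ 0 := (_root_.map_ne_zero _).2 he
  obtain ⟨T, hT⟩ : ∃ T, T = algebraMap F (AlgebraicClosure F) ((typeCPoly s a e).eval 0) := ⟨_, rfl⟩
  have hT₀ : aeval (0 : AlgebraicClosure F) (typeCPoly s a e) = T := by
    rw [hT, ← map_zero (algebraMap F (AlgebraicClosure F)), aeval_algebraMap_apply,
      coe_aeval_eq_eval]
  have hT0 : T ≠ 0 := fun h0 => he' (by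
    simpa using aeval_typeCPoly_eq_zero hsr hs hM a e hb hb0 hbq (hFq e) (x := 0)
      (zero_pow (by positivity)) (hT₀.trans h0))
  obtain ⟨E, hE, hET⟩ := exists_twist_parameter (s := s) (h := h) a hb hb0 hT0
  obtain ⟨ε, hε⟩ : ∃ ε, E ^ 3 ^ m = ε * E := ⟨E ^ 3 ^ m / E, by field_simp⟩
  have hε' := twist_pow hs hE hb hb0 hET (by rw [hT, hFq]) (hFq a) hbq hε
  have hε0 : ε ≠ 0 := by rintro rfl; simp at hε'
  obtain ⟨N₀, w₀, H₀, hN₀, hX₀⟩ := exists_isLift (x := 0) hsr hs a e hb hb0 hE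
    (by rwa [zero_add]) (by rw [hT₀, hET])
  rw [zero_add] at hX₀
  obtain ⟨κ, hκ, f₀, g₀⟩ := H₀.exists_sign hsr hs hE hb0 hbq hε hε' (by rw [← hX₀, hFq])
  have hκ0 : κ ≠ 0 := by rcases hκ with rfl | rfl <;> simp
  have hneg : ∀ N w, polar s N₀ w₀ (-N) (-w) = -polar s N₀ w₀ N w := fun N w => by
    simp only [polar, hodd.neg_pow]; ring
  have hsgn : ∀ {N w N' w' : AlgebraicClosure F}, IsLift s E N w → IsLift s E N' w' →
      b * N ^ (2 * h + 2) = b * N' ^ (2 * h + 2) →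
      polar s N₀ w₀ N w = polar s N₀ w₀ N' w' ∨ polar s N₀ w₀ N w = -polar s N₀ w₀ N' w' := by
    intro N w N' w' H H' hX
    rcases H.eq_or_eq_neg hsr hs H' hE (mul_left_cancel₀ hb0 hX) with ⟨rfl, rfl⟩ | ⟨rfl, rfl⟩
    · exact Or.inl rfl
    · exact Or.inr (hneg N' w')
  -- Orthogonality to the base lift; the sign ambiguity of lifts does not affect it.
  let P : AlgebraicClosure F → Prop := fun y => ∀ N w, IsLift s E N w →
    algebraMap F _ e - y = b * N ^ (2 * h + 2) → polar s N₀ w₀ N w = 0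
  have hP : ∀ {y N w}, IsLift s E N w → algebraMap F _ e - y = b * N ^ (2 * h + 2) →
      (P y ↔ polar s N₀ w₀ N w = 0) := by
    intro y N w H hX
    refine ⟨fun hy => hy N w H hX, fun h0 N' w' H' hX' => ?_⟩
    rcases hsgn H' H (hX'.symm.trans hX) with h1 | h1 <;> rw [h1, h0]
    exact neg_zero
  have hlift : ∀ d : AlgebraicClosure F, d ^ s = d → d ^ 2 ≠ 1 →
      ∃ y ∈ (vPoly (typeCPoly s a e)).rootSet (AlgebraicClosure F), (P y ↔ d = 0) := by
    intro d hd hd1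
    obtain ⟨N, w, H, hN, hp⟩ := H₀.exists_polar_eq hsr hs hE hN₀ hd hd1
    have hX : algebraMap F _ e - (algebraMap F _ e - b * N ^ (2 * h + 2)) =
      b * N ^ (2 * h + 2) := by ring
    refine ⟨algebraMap F _ e - b * N ^ (2 * h + 2), (mem_rootSet_vPoly hg _).2 ⟨?_, ?_⟩, ?_⟩
    -- The root `0` would lift to plus or minus the base lift, whose pairing with it is `±1`; this
    -- is excluded by `d ^ 2 ≠ 1`.
    · intro h0
      have h1 := hsgn H H₀ (by rw [← hX₀]; exact (sub_eq_zero.1 h0).symm)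
      have h2 : polar s N₀ w₀ N₀ w₀ = -1 := by
        rw [polar]
        linear_combination 2 * H₀.norm + (w₀ ^ 2 + 1) * three_eq_zero (AlgebraicClosure F)
      rw [hp, h2] at h1
      apply hd1
      rcases h1 with h1 | h1
      · linear_combination -(d + 1) * h1
      · linear_combination (-d + 1) * h1
    · rw [← hT]
      exact H.aeval_eq hsr hs a e hN hb hb0 (by ring) hET
    · rw [hP H hX, hp, neg_eq_zero]
  obtain ⟨y₁, hy₁, hP₁⟩ := hlift 0 (zero_pow (by omega)) (by simp)
  obtain ⟨d, hd1, hd2⟩ := exists_pow_eq_self (K := AlgebraicClosure F) hsr hr hs3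
  have hd0 : d ≠ 0 := by
    rintro rfl
    rw [zero_pow (by omega)] at hd1
    exact zero_ne_one hd1
  obtain ⟨y₂, hy₂, hP₂⟩ := hlift d
    (by rw [← Nat.sub_add_cancel (show 1 ≤ s by omega), pow_succ, hd1, one_mul]) hd2
  refine not_rootsFormUniqueOrbit P (fun y hy => ?_) hy₁ hy₂ (hP₁.2 rfl) (fun h0 => hd0 (hP₂.1 h0))
  obtain ⟨hy0, hyT⟩ := (mem_rootSet_vPoly hg y).1 hy
  rw [← hT] at hyT
  obtain ⟨N, w, H, hN, hX⟩ := exists_isLift (x := -y) hsr hs a e hb hb0 hE (by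
    intro h0
    rw [aeval_typeCPoly hs, h0, zero_mul, zero_mul] at hyT
    exact hT0 hyT.symm) (by rw [hyT, hET])
  rw [neg_add_eq_sub] at hX
  have hX' : algebraMap F _ e - y ^ Nat.card F = b * (ε⁻¹ * N ^ 3 ^ m) ^ (2 * h + 2) := by
    rw [← mul_pow_twist hε' hbq, ← hX, sub_pow_char_pow, hFq, hq]
  -- The base lift is fixed up to the sign `κ`, so the twist preserves vanishing of the pairing with
  -- it.
  have hpol := polar_pow_eq (N₂ := N) (w₂ := w) (N := ε⁻¹ * N ^ 3 ^ m) hs hε' f₀ g₀ hκ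
    (by field_simp) rfl
  rw [hP H hX, hP (H.twist hs hε hε') hX']
  constructor
  · intro h0
    rw [h0, zero_pow (by positivity)] at hpol
    exact (mul_eq_zero.1 hpol.symm).resolve_left hκ0
  · intro h0
    rw [h0, mul_zero] at hpol
    exact pow_eq_zero_iff (by positivity) |>.1 hpol

end NotGood
end GoodPolynomials

theorem proposition5p1 {F : Type*} [Field F] [Finite F] (m r s : ℕ)
    (hq : Nat.card F = 3 ^ m) (hs : s = 3 ^ r) (hs3 : 3 < s) (hgcd : Nat.gcd r (2 * m) = 1)
    (a e : F) (ha : ¬ IsSquare a) :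
    GoodPolynomials.IsExceptional (GoodPolynomials.typeCPoly s a e) ∧
      (Polynomial.derivative (GoodPolynomials.typeCPoly s a e)).eval 0 ≠ 0 ∧
      ¬ GoodPolynomials.IsGood (GoodPolynomials.typeCPoly s a e) := by
  have : Fintype F := Fintype.ofFinite F
  have : CharP F 3 := charP_of_card_eq_prime_pow (f := m) (Nat.card_eq_fintype_card.symm.trans hq)
  have : CharP (AlgebraicClosure F) 3 := charP_of_injective_algebraMap
    (algebraMap F (AlgebraicClosure F)).injective 3
  have hM : Nat.gcd r m = 1 := Nat.Coprime.coprime_mul_left_right hgcd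
  have hodd : Odd r := Nat.Coprime.odd_of_right
    (Nat.Coprime.coprime_mul_right_right hgcd)
  have hr : r ≠ 0 := by rintro rfl; omega
  obtain ⟨h, hs4⟩ : ∃ h, s = 4 * h + 3 := by
    obtain ⟨k, rfl⟩ := hodd
    have : s % 4 = 3 := by
      rw [hs, pow_succ, pow_mul, Nat.mul_mod, Nat.pow_mod]; norm_num
    exact ⟨s / 4, by omega⟩
  obtain ⟨b, hb, hb0, hbq⟩ :=
    GoodPolynomials.exists_sqrt_pow_card hq (AlgebraicClosure F) ha
  have hd := GoodPolynomials.eval_zero_derivative_typeCPoly hs hs4 hr hM hb hb0 hbq (e := e)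
    (by rw [← hq, Nat.card_eq_fintype_card, FiniteField.pow_card])
  refine ⟨GoodPolynomials.typeCPoly_isExceptional hq hs hs4 hM a e ha, hd, fun hgood => ?_⟩
  by_cases he : e = 0
  · subst he
    exact GoodPolynomials.not_rootsFormUniqueOrbit_zero hq hs hs4 hr hs3 hb hb0 hd
      hgood.uniqueOrbit
  · exact GoodPolynomials.not_rootsFormUniqueOrbit_of_ne_zero hq hs hs4 hr hs3 hM he hb hb0 hbq hd
      hgood.uniqueOrbit
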